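/- Fix $n\ge 0$ and $d_1,\dots,d_n\ge 1$, and put $D=\prod_i d_i$. A $(d_1\times\cdots\times d_n)$-game is given by payoff tensors $X=(X^{(1)},\dots,X^{(n)})$, $X^{(i)}\in\mathbb R^{d_1\times\cdots\times d_n}$. For a player $i$, strategies $k,l\in[d_i]$ and a choice $j$ of strategies of the other players, write $(k,j)$ for the joint strategy in which $i$ plays $k$ and the others play $j$. The payoff-difference vector of $X$ is the vector $Y(X)\in\mathbb R^M$, $M=\sum_i\binom{d_i}{2}\prod_{m\ne i}d_m$, with coordinates $Y^{(i)}_j(k,l)=X^{(i)}_{(k,j)}-X^{(i)}_{(l,j)}$, $k<l$. For any $Y\in\mathbb R^M$ put $Y^{(i)}_j(l,k)=-Y^{(i)}_j(k,l)$ for $k<l$, and $Y^{(i)}_j(k,k)=0$. The correlated equilibrium space $\mathcal S\subseteq\mathbb R^M$ is the linear subspace of all $Y$ with $Y^{(i)}_j(k,l)+Y^{(i)}_j(l,t)=Y^{(i)}_j(k,t)$ for all $i$ with $d_i\ge 3$, all $k,l,t\in[d_i]$ and all $j$. For $Y\in\mathbb R^M$ let $U(Y)$ be the matrix with $D$ columns,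 indexed by the joint strategies $s$, and with one row $U^{(i)}_{kl}$ for each $i$ and each $k\ne l$ in $[d_i]$, whose entry at $s$ is $Y^{(i)}_{j}(k,l)$ if $s=(k,j)$ and $0$ if player $i$ does not play $k$ in $s$. Let $A(Y)=\begin{pmatrix}U(Y)\\ \mathrm{Id}_D\end{pmatrix}$. The correlated equilibrium cone is $C(Y)=\{p\in\mathbb R^D: A(Y)p\ge 0\}$, and the region of full-dimensionality is $\mathcal D=\{Y\in\mathcal S:\dim C(Y)=D\}$. The correlated equilibrium polytope $P_G$ of the game $G$ with payoffs $X$ is the set of probability vectors $p\in\mathbb R^D$ with $\sum_j\bigl(X^{(i)}_{(k,j)}-X^{(i)}_{(l,j)}\bigr)p_{(k,j)}\ge 0$ for all $i$ and all $k,l\in[d_i]$. A semialgebraic set is one defined by a Boolean combination of finitely many polynomial inequalities. Let $\pi_Y:\mathbb R^{D}\times\mathbb R^M\to\mathbb R^M$ be the coordinate projection, and let $>$ between vectors be strict in every coordinate. **Theorem.** 1. The region $\mathcal D$ and the set $\pi_Y(\{(x,Y): A(Y)x>0\})\cap\mathcal S$ are semialgebraic. 2. These two sets agree wherever no incentive constraint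 is trivial, and the second contains only such points: $$\mathcal D\cap\{Y: U^{(i)}_{kl}(Y)\ne 0\text{ for all }i\text{ and all }k\ne l\}=\pi_Y(\{(x,Y): A(Y)x>0\})\cap\mathcal S.$$ 3. Without this restriction, $$\mathcal D=\pi_Y(\{(x,Y): a\cdot x>0\text{ for every nonzero row }a\text{ of }A(Y)\})\cap\mathcal S.$$ 4. The space $\mathcal S$ is exactly the set of the payoff-difference vectors $Y(X)$ of $(d_1\times\cdots\times d_n)$-games, and for each such game $G$ one has $Y(X)\in\mathcal D$ if and only if $P_G$ has its maximal dimension $D-1$. -/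

import Mathlib

namespace CorrelatedEq

/-- Pure joint strategies of a `(d 0 × ⋯ × d (n-1))`-game. The vectors `p` (and `x`) live in
`JointStrategy d → ℝ`, a real vector space of dimension `D = ∏ i, d i`. -/
abbrev JointStrategy {n : ℕ} (d : Fin n → ℕ) : Type := (i : Fin n) → Fin (d i)

/-- Joint strategies of all the players except player `i`. -/
abbrev OthersStrategy {n : ℕ} (d : Fin n → ℕ) (i : Fin n) : Type :=
  (m : {m : Fin n // m ≠ i}) → Fin (d m)

/-- The joint strategy in which player `i` plays `k` and the others play `j`. -/
def extend {n : ℕ} {d : Fin n → ℕ} {i : Fin n} (k : Fin (d i)) (j : OthersStrategy d i) :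
    JointStrategy d :=
  (Equiv.piSplitAt i (fun m => Fin (d m))).symm (k, j)

/-- The strategies of the players other than `i` in a joint strategy. -/
def others {n : ℕ} {d : Fin n → ℕ} (i : Fin n) (s : JointStrategy d) : OthersStrategy d i :=
  fun m => s m

/-- Payoff tensors: `X i s` is the payoff of player `i` at the joint strategy `s`. -/
abbrev Payoffs {n : ℕ} (d : Fin n → ℕ) : Type := Fin n → JointStrategy d → ℝ

/-- The names of the variables `Y^{(i)}_{j}(k,l)` with `k < l`; there are
`M = ∑ i, (d i).choose 2 * ∏ m ≠ i, d m` of them. -/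
abbrev DiffIndex {n : ℕ} (d : Fin n → ℕ) : Type :=
  (i : Fin n) × ({kl : Fin (d i) × Fin (d i) // kl.1 < kl.2} × OthersStrategy d i)

/-- The space `ℝ^M` of vectors `Y`. -/
abbrev DiffVec {n : ℕ} (d : Fin n → ℕ) : Type := DiffIndex d → ℝ

/-- `Y^{(i)}_{j}(k,l)` for arbitrary `k, l`, where `Y^{(i)}_{j}(k,l) = - Y^{(i)}_{j}(l,k)`. -/
def diff {n : ℕ} {d : Fin n → ℕ} (Y : DiffVec d) (i : Fin n) (k l : Fin (d i))
    (j : OthersStrategy d i) : ℝ :=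
  if h : k < l then Y ⟨i, ⟨(k, l), h⟩, j⟩
  else if h : l < k then - Y ⟨i, ⟨(l, k), h⟩, j⟩
  else 0

theorem diff_zero {n : ℕ} {d : Fin n → ℕ} (i : Fin n) (k l : Fin (d i))
    (j : OthersStrategy d i) : diff (0 : DiffVec d) i k l j = 0 := by
  unfold diff
  split_ifs <;> simp

theorem diff_add {n : ℕ} {d : Fin n → ℕ} (Y Z : DiffVec d) (i : Fin n) (k l : Fin (d i))
    (j : OthersStrategy d i) : diff (Y + Z) i k l j = diff Y i k l j + diff Z i k l j := by
  unfold diff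
  split_ifs
  · simp
  · simp only [Pi.add_apply]; ring
  · simp

theorem diff_smul {n : ℕ} {d : Fin n → ℕ} (c : ℝ) (Y : DiffVec d) (i : Fin n) (k l : Fin (d i))
    (j : OthersStrategy d i) : diff (c • Y) i k l j = c * diff Y i k l j := by
  unfold diff
  split_ifs <;> simp

/-- The payoff-difference vector `Y` of the game with payoffs `X`. -/
def payoffDiff {n : ℕ} {d : Fin n → ℕ} (X : Payoffs d) : DiffVec d :=
  fun v => X v.1 (extend v.2.1.1.1 v.2.2) - X v.1 (extend v.2.1.1.2 v.2.2)

/-- The correlated equilibrium space `𝒮 ⊆ ℝ^M`. -/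
def corrSpace {n : ℕ} (d : Fin n → ℕ) : Submodule ℝ (DiffVec d) where
  carrier := {Y | ∀ i : Fin n, 3 ≤ d i → ∀ (k l t : Fin (d i)) (j : OthersStrategy d i),
    diff Y i k l j + diff Y i l t j = diff Y i k t j}
  zero_mem' := by
    intro i _ k l t j
    simp only [diff_zero, add_zero]
  add_mem' := by
    intro Y Z hY hZ i hi k l t j
    have h1 := hY i hi k l t j
    have h2 := hZ i hi k l t j
    simp only [diff_add]
    linarith
  smul_mem' := by
    intro c Y hY i hi k l t j
    have h1 := hY i hi k l t j
    simp only [diff_smul]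
    rw [← h1]
    ring

/-- The labels `(i, k, l)`, `k ≠ l`, of the `N = ∑ i, d i * (d i - 1)` incentive constraints. -/
abbrev IncentiveIndex {n : ℕ} (d : Fin n → ℕ) : Type :=
  (i : Fin n) × {kl : Fin (d i) × Fin (d i) // kl.1 ≠ kl.2}

/-- The `N × D` matrix `U(Y)`, with rows `U^{(i)}_{kl}`. -/
def incentiveMatrix {n : ℕ} {d : Fin n → ℕ} (Y : DiffVec d) :
    Matrix (IncentiveIndex d) (JointStrategy d) ℝ :=
  Matrix.of fun r s =>
    if s r.1 = r.2.1.1 then diff Y r.1 r.2.1.1 r.2.1.2 (others r.1 s) else 0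

/-- The `(N + D) × D` matrix `A(Y)`: the rows of `U(Y)`, then those of the identity. -/
def coneMatrix {n : ℕ} {d : Fin n → ℕ} (Y : DiffVec d) :
    Matrix (IncentiveIndex d ⊕ JointStrategy d) (JointStrategy d) ℝ :=
  Matrix.fromRows (incentiveMatrix Y) 1

/-- The correlated equilibrium cone `C(Y) = {p | A(Y) p ≥ 0}`. -/
def corrCone {n : ℕ} {d : Fin n → ℕ} (Y : DiffVec d) : Set (JointStrategy d → ℝ) :=
  {p | ∀ r, 0 ≤ (coneMatrix Y).mulVec p r}

/-- The correlated equilibrium polytope `P_G` of the game with payoffs `X`. -/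
def corrPolytope {n : ℕ} {d : Fin n → ℕ} (X : Payoffs d) : Set (JointStrategy d → ℝ) :=
  {p | p ∈ stdSimplex ℝ (JointStrategy d) ∧
    ∀ (i : Fin n) (k l : Fin (d i)),
      0 ≤ ∑ j : OthersStrategy d i, (X i (extend k j) - X i (extend l j)) * p (extend k j)}

/-- The dimension of a (nonempty) convex set: the dimension of its affine hull. -/
noncomputable def convexDim {ι : Type*} (s : Set (ι → ℝ)) : ℕ :=
  Module.finrank ℝ (affineSpan ℝ s).direction

/-- The region of full-dimensionality `𝒟 = {Y ∈ 𝒮 | dim C(Y) = D}`. -/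
def fullDimRegion {n : ℕ} (d : Fin n → ℕ) : Set (DiffVec d) :=
  {Y | Y ∈ corrSpace d ∧ convexDim (corrCone Y) = ∏ i, d i}

/-- Semialgebraic sets: the Boolean combinations of finitely many polynomial inequalities. -/
inductive IsSemialgebraic {σ : Type*} : Set (σ → ℝ) → Prop
  | pos (f : MvPolynomial σ ℝ) : IsSemialgebraic {y | 0 < MvPolynomial.eval y f}
  | compl {s : Set (σ → ℝ)} : IsSemialgebraic s → IsSemialgebraic sᶜ
  | union {s t : Set (σ → ℝ)} : IsSemialgebraic s → IsSemialgebraic t → IsSemialgebraic (s ∪ t)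

/-- `π_Y({(x, Y) | A(Y) x > 0})`, with `π_Y` the coordinate projection to `ℝ^M`. -/
def strictProjection {n : ℕ} (d : Fin n → ℕ) : Set (DiffVec d) :=
  Prod.snd '' {z : (JointStrategy d → ℝ) × DiffVec d | ∀ r, 0 < (coneMatrix z.2).mulVec z.1 r}

/-- The same projection, where only the nonzero rows of `A(Y)` impose a strict inequality. -/
def reducedStrictProjection {n : ℕ} (d : Fin n → ℕ) : Set (DiffVec d) :=
  Prod.snd '' {z : (JointStrategy d → ℝ) × DiffVec d |
    ∀ r, coneMatrix z.2 r ≠ 0 → 0 < (coneMatrix z.2).mulVec z.1 r}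

end CorrelatedEq

/-! The cone C(Y) is cut out by finitely many homogeneous inequalities. Being convex, it has
dimension D exactly when it has an interior point, and x is interior precisely when every nonzero
row of A(Y) is strictly positive on it (`interior_setOf_mulVec_nonneg_nonempty_iff`). This describes
the whole region (`fullDimRegion_eq`). Identity rows never vanish, so demanding strictness of all
rows only adds that no incentive row is zero (`strictProjection_eq`).

Both projections are semialgebraic without Tarski–Seidenberg: the system is linear in x, so
Fourier–Motzkin elimination removes the unknowns one at a time, after a case split on the signs of
the leading coefficients (`isSemialgebraic_exists_affine_fin`). Zero rows are handled by a further
finite case split on which rows vanish.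

For games, the condition defining 𝒮 makes each family of differences additive, hence the differences
of a payoff (`range_payoffDiff`). The polytope is the slice of the cone by the hyperplane of
coordinate sum 1 and spans the same linear space, one dimension larger than the polytope when the
latter is nonempty. -/

namespace CorrelatedEq

/-! ### Semialgebraic sets and Fourier–Motzkin elimination. -/

section Semialgebraic

variable {σ : Type*}

theorem IsSemialgebraic.inter {s t : Set (σ → ℝ)} (hs : IsSemialgebraic s)
    (ht : IsSemialgebraic t) : IsSemialgebraic (s ∩ t) := by
  have h := (hs.compl.union ht.compl).compl
  rwa [Set.compl_union, compl_compl, compl_compl] at h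

theorem isSemialgebraic_empty : IsSemialgebraic (∅ : Set (σ → ℝ)) := by
  have h := IsSemialgebraic.pos (0 : MvPolynomial σ ℝ)
  simpa using h

theorem isSemialgebraic_iUnion {ι : Type*} [Finite ι] {s : ι → Set (σ → ℝ)}
    (hs : ∀ i, IsSemialgebraic (s i)) : IsSemialgebraic (⋃ i, s i) := by
  classical
  have := Fintype.ofFinite ι
  have key : ∀ t : Finset ι, IsSemialgebraic (⋃ i ∈ t, s i) := by
    intro t
    induction t using Finset.induction_on with
    | empty => simpa using isSemialgebraic_empty
    | insert a t _ ih =>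
      rw [Finset.set_biUnion_insert]
      exact (hs a).union ih
  simpa using key Finset.univ

theorem isSemialgebraic_iInter {ι : Type*} [Finite ι] {s : ι → Set (σ → ℝ)}
    (hs : ∀ i, IsSemialgebraic (s i)) : IsSemialgebraic (⋂ i, s i) := by
  have h := (isSemialgebraic_iUnion fun i => (hs i).compl).compl
  rwa [Set.compl_iUnion, Set.iInter_congr fun i => compl_compl (s i)] at h

theorem isSemialgebraic_eval_neg (f : MvPolynomial σ ℝ) :
    IsSemialgebraic {y | MvPolynomial.eval y f < 0} := by
  simpa using IsSemialgebraic.pos (-f)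

theorem isSemialgebraic_eval_eq_zero (f : MvPolynomial σ ℝ) :
    IsSemialgebraic {y | MvPolynomial.eval y f = 0} := by
  convert ((IsSemialgebraic.pos f).union (isSemialgebraic_eval_neg f)).compl using 1
  ext y
  simp only [Set.mem_ofPred_eq, Set.mem_compl_iff, Set.mem_union, not_or, not_lt]
  exact ⟨fun h => ⟨h.le, h.ge⟩, fun h => le_antisymm h.1 h.2⟩

theorem isSemialgebraic_sign_eval_eq (f : MvPolynomial σ ℝ) (c : SignType) :
    IsSemialgebraic {y | SignType.sign (MvPolynomial.eval y f) = c} := by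
  cases c with
  | zero =>
    have h := isSemialgebraic_eval_eq_zero f
    simpa only [SignType.zero_eq_zero, sign_eq_zero_iff] using h
  | neg =>
    have h := isSemialgebraic_eval_neg f
    simpa only [SignType.neg_eq_neg_one, sign_eq_neg_one_iff] using h
  | pos =>
    have h := IsSemialgebraic.pos f
    simpa only [SignType.pos_eq_one, sign_eq_one_iff] using h

/-- One step of Fourier–Motzkin elimination for strict inequalities in one unknown. -/
theorem exists_forall_add_mul_pos_iff {R : Type*} [Finite R] (c a : R → ℝ) :
    (∃ t, ∀ r, 0 < c r + a r * t) ↔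
      (∀ r, a r = 0 → 0 < c r) ∧
        ∀ r s, 0 < a r → a s < 0 → 0 < a r * c s - a s * c r := by
  constructor
  · rintro ⟨t, ht⟩
    refine ⟨fun r hr => by simpa [hr] using ht r, fun r s hr hs => ?_⟩
    have h1 := mul_pos hr (ht s)
    have h2 := mul_pos (neg_pos.2 hs) (ht r)
    linarith
  · rintro ⟨h0, h⟩
    have hlt : ∀ x ∈ (fun r => - c r / a r) '' {r | 0 < a r},
        ∀ y ∈ (fun r => - c r / a r) '' {r | a r < 0}, x < y := by
      rintro _ ⟨r, hr, rfl⟩ _ ⟨s, hs, rfl⟩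
      have h1 := h r s hr hs
      simp only [Set.mem_ofPred_eq] at hr hs
      change -c r / a r < -c s / a s
      rw [← neg_div_neg_eq (-c s) (a s), div_lt_div_iff₀ hr (neg_pos.2 hs)]
      linarith
    obtain ⟨t, ht1, ht2⟩ := Set.Finite.exists_between' (Set.toFinite _) (Set.toFinite _) hlt
    refine ⟨t, fun r => ?_⟩
    rcases lt_trichotomy (a r) 0 with hr | hr | hr
    · have h1 : t < -c r / a r := ht2 _ ⟨r, hr, rfl⟩
      rw [lt_div_iff_of_neg hr] at h1
      linarith
    · simpa [hr] using h0 r hr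
    · have h1 : -c r / a r < t := ht1 _ ⟨r, hr, rfl⟩
      rw [div_lt_iff₀ hr] at h1
      linarith

/-- The set of parameters for which a finite system of strict inequalities, affine in the unknowns
with coefficients polynomial in the parameters, is solvable. -/
theorem isSemialgebraic_exists_affine_fin (m : ℕ) {R : Type} [Finite R]
    (b : R → MvPolynomial σ ℝ) (a : R → Fin m → MvPolynomial σ ℝ) :
    IsSemialgebraic {y | ∃ x : Fin m → ℝ, ∀ r,
      0 < MvPolynomial.eval y (b r) + ∑ k, MvPolynomial.eval y (a r k) * x k} := by
  classical
  induction m generalizing R with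
  | zero =>
    have h := isSemialgebraic_iInter fun r => IsSemialgebraic.pos (b r)
    convert h using 1
    ext y
    simp
  | succ m ih =>
    -- For a fixed sign pattern `ε` of the coefficients of the first unknown, the eliminated system
    -- is indexed by all pairs: a row of sign 0 is kept, a (positive, negative) pair is combined,
    -- and every other pair gets the vacuous `0 < 1`.
    let b' (ε : R → SignType) (q : R × R) : MvPolynomial σ ℝ :=
      if ε q.1 = 0 then b q.1
      else if ε q.1 = 1 ∧ ε q.2 = -1 then a q.1 0 * b q.2 - a q.2 0 * b q.1
      else 1
    let a' (ε : R → SignType) (q : R × R) (k : Fin m) : MvPolynomial σ ℝ :=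
      if ε q.1 = 0 then a q.1 k.succ
      else if ε q.1 = 1 ∧ ε q.2 = -1 then
        a q.1 0 * a q.2 k.succ - a q.2 0 * a q.1 k.succ
      else 0
    have h : IsSemialgebraic (⋃ ε : R → SignType,
        (⋂ r, {y | SignType.sign (MvPolynomial.eval y (a r 0)) = ε r}) ∩
          {y | ∃ x : Fin m → ℝ, ∀ q, 0 < MvPolynomial.eval y (b' ε q) +
            ∑ k, MvPolynomial.eval y (a' ε q k) * x k}) :=
      isSemialgebraic_iUnion fun ε =>
        (isSemialgebraic_iInter fun r => isSemialgebraic_sign_eval_eq _ _).inter (ih _ _)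
    convert h using 1
    ext y
    have hsplit : (∃ x : Fin (m + 1) → ℝ, ∀ r,
          0 < MvPolynomial.eval y (b r) + ∑ k, MvPolynomial.eval y (a r k) * x k) ↔
        ∃ x : Fin m → ℝ, ∃ t : ℝ, ∀ r, 0 < (MvPolynomial.eval y (b r) +
          ∑ k, MvPolynomial.eval y (a r k.succ) * x k) + MvPolynomial.eval y (a r 0) * t := by
      constructor
      · rintro ⟨x, hx⟩
        refine ⟨fun k => x k.succ, x 0, fun r => ?_⟩
        have := hx r
        rw [Fin.sum_univ_succ] at this
        linarith
      · rintro ⟨x, t, hx⟩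
        refine ⟨Fin.cons t x, fun r => ?_⟩
        have := hx r
        rw [Fin.sum_univ_succ]
        simp only [Fin.cons_zero, Fin.cons_succ]
        linarith
    simp only [Set.mem_ofPred_eq, hsplit, exists_forall_add_mul_pos_iff, Set.mem_iUnion,
      Set.mem_inter_iff, Set.mem_iInter]
    have hcomb : ∀ (r s : R) (x : Fin m → ℝ),
        MvPolynomial.eval y (a r 0 * b s - a s 0 * b r) +
          ∑ k, MvPolynomial.eval y (a r 0 * a s k.succ - a s 0 * a r k.succ) * x k =
        MvPolynomial.eval y (a r 0) * (MvPolynomial.eval y (b s) +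
            ∑ k, MvPolynomial.eval y (a s k.succ) * x k) -
          MvPolynomial.eval y (a s 0) * (MvPolynomial.eval y (b r) +
            ∑ k, MvPolynomial.eval y (a r k.succ) * x k) := by
      intro r s x
      simp only [map_sub, map_mul, mul_add, Finset.mul_sum, sub_mul, Finset.sum_sub_distrib,
        mul_assoc]
      ring
    constructor
    · rintro ⟨x, h0, h1⟩
      refine ⟨fun r => SignType.sign (MvPolynomial.eval y (a r 0)), fun r => rfl, x, ?_⟩
      rintro ⟨r, s⟩
      by_cases hr : SignType.sign (MvPolynomial.eval y (a r 0)) = 0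
      · simpa only [b', a', if_pos hr] using h0 r (sign_eq_zero_iff.1 hr)
      · by_cases hrs : SignType.sign (MvPolynomial.eval y (a r 0)) = 1 ∧
            SignType.sign (MvPolynomial.eval y (a s 0)) = -1
        · simp only [b', a', if_neg hr, if_pos hrs, hcomb]
          exact h1 r s (sign_eq_one_iff.1 hrs.1) (sign_eq_neg_one_iff.1 hrs.2)
        · simp [b', a', if_neg hr, if_neg hrs]
    · rintro ⟨ε, hε, x, hx⟩
      refine ⟨x, fun r hr => ?_, fun r s hr hs => ?_⟩
      · have hr' : ε r = 0 := by rw [← hε r, hr, sign_zero]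
        simpa only [b', a', if_pos hr'] using hx (r, r)
      · have hr' : ε r = 1 := by rw [← hε r, sign_pos hr]
        have hs' : ε s = -1 := by rw [← hε s, sign_neg hs]
        have h2 := hx (r, s)
        have h0 : ε r ≠ 0 := by rw [hr']; decide
        simp only [b', a', if_neg h0, if_pos (And.intro hr' hs'), hcomb] at h2
        exact h2

theorem isSemialgebraic_exists_mulVec_pos {R ι : Type} [Finite R] [Fintype ι]
    (a : Matrix R ι (MvPolynomial σ ℝ)) :
    IsSemialgebraic {y | ∃ x : ι → ℝ, ∀ r,
      0 < (a.map (MvPolynomial.eval y)).mulVec x r} := by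
  let e := Fintype.equivFin ι
  convert isSemialgebraic_exists_affine_fin (Fintype.card ι) (fun _ : R => 0)
    (fun r k => a r (e.symm k)) using 1
  ext y
  have hsum : ∀ (x : ι → ℝ) (r : R), (a.map (MvPolynomial.eval y)).mulVec x r =
      ∑ k, MvPolynomial.eval y (a r (e.symm k)) * x (e.symm k) := fun x r =>
    (Equiv.sum_comp e.symm fun s => MvPolynomial.eval y (a r s) * x s).symm
  simp only [Set.mem_ofPred_eq, map_zero, zero_add]
  constructor
  · rintro ⟨x, hx⟩
    exact ⟨fun k => x (e.symm k), fun r => hsum x r ▸ hx r⟩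
  · rintro ⟨x, hx⟩
    refine ⟨fun s => x (e s), fun r => ?_⟩
    rw [hsum]
    simpa using hx r

/-- The variant of `isSemialgebraic_exists_mulVec_pos` in which zero rows impose no condition. -/
theorem isSemialgebraic_exists_mulVec_pos_of_ne_zero {R ι : Type} [Finite R] [Fintype ι]
    (a : Matrix R ι (MvPolynomial σ ℝ)) :
    IsSemialgebraic {y | ∃ x : ι → ℝ, ∀ r, a.map (MvPolynomial.eval y) r ≠ 0 →
      0 < (a.map (MvPolynomial.eval y)).mulVec x r} := by
  have hrow : ∀ r, IsSemialgebraic {y | a.map (MvPolynomial.eval y) r = 0} := by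
    intro r
    convert isSemialgebraic_iInter fun s => isSemialgebraic_eval_eq_zero (a r s) using 1
    ext y
    simp [funext_iff]
  -- Stratify the parameters by the set `T` of rows that do not vanish; on each stratum only the
  -- rows in `T` remain.
  have hset : ∀ T : Set R, IsSemialgebraic {y | ∀ r, a.map (MvPolynomial.eval y) r ≠ 0 ↔ r ∈ T} := by
    intro T
    rw [Set.ofPred_forall]
    refine isSemialgebraic_iInter fun r => ?_
    by_cases hr : r ∈ T
    · simp only [hr, iff_true]
      exact (hrow r).compl
    · simpa [hr] using hrow r
  convert isSemialgebraic_iUnion fun T : Set R =>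
    (hset T).inter (isSemialgebraic_exists_mulVec_pos (R := T) fun r => a r) using 1
  ext y
  simp only [Set.mem_iUnion, Set.mem_inter_iff, Set.mem_ofPred_eq]
  constructor
  · rintro ⟨x, hx⟩
    exact ⟨{r | a.map (MvPolynomial.eval y) r ≠ 0}, fun r => Iff.rfl, x, fun r => hx r r.2⟩
  · rintro ⟨T, hT, x, hx⟩
    exact ⟨x, fun r hr => hx ⟨r, (hT r).1 hr⟩⟩

end Semialgebraic

/-! ### Dimension and interior of convex cones. -/

section Cones

variable {ι : Type*}

theorem convexDim_eq_finrank_span {s : Set (ι → ℝ)} (h0 : 0 ∈ s) :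
    convexDim s = Module.finrank ℝ (Submodule.span ℝ s) := by
  have h : vectorSpan ℝ s = Submodule.span ℝ s := by
    simp only [vectorSpan_eq_span_vsub_set_right ℝ h0, vsub_eq_sub, sub_zero, Set.image_id']
  rw [convexDim, direction_affineSpan, h]

/-- A convex set containing the origin is full-dimensional iff it has an interior point. -/
theorem convexDim_eq_card_iff [Fintype ι] {s : Set (ι → ℝ)} (hs : Convex ℝ s) (hne : s.Nonempty) :
    convexDim s = Fintype.card ι ↔ (interior s).Nonempty := by
  rw [hs.interior_nonempty_iff_affineSpan_eq_top,
    ← AffineSubspace.direction_eq_top_iff_of_nonempty ((affineSpan_nonempty ℝ).2 hne), convexDim]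
  constructor
  · intro h
    exact Submodule.eq_top_of_finrank_eq (by rw [h, Module.finrank_fintype_fun_eq_card])
  · intro h
    rw [h, finrank_top, Module.finrank_fintype_fun_eq_card]

theorem convex_setOf_mulVec_nonneg {R : Type*} [Fintype ι] (A : Matrix R ι ℝ) :
    Convex ℝ {p | ∀ r, 0 ≤ A.mulVec p r} := by
  intro p hp q hq a b ha hb _ r
  rw [Matrix.mulVec_add, Matrix.mulVec_smul, Matrix.mulVec_smul]
  exact add_nonneg (mul_nonneg ha (hp r)) (mul_nonneg hb (hq r))

/-- An interior point can be pushed slightly in the direction `-A r` and still satisfy row `r`, so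
that row was strict there. Conversely strict inequalities are open, and zero rows hold everywhere.
-/
theorem interior_setOf_mulVec_nonneg_nonempty_iff {R : Type*} [Finite R] [Fintype ι]
    (A : Matrix R ι ℝ) :
    (interior {p | ∀ r, 0 ≤ A.mulVec p r}).Nonempty ↔
      ∃ x, ∀ r, A r ≠ 0 → 0 < A.mulVec x r := by
  constructor
  · rintro ⟨x, hx⟩
    refine ⟨x, fun r hr => ?_⟩
    have hcont : Filter.Tendsto (fun t : ℝ => x - t • A r) (nhdsWithin 0 (Set.Ioi 0)) (nhds x) := by
      have h : Continuous fun t : ℝ => x - t • A r := by fun_prop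
      have h2 := h.tendsto 0
      simp only [zero_smul, sub_zero] at h2
      exact h2.mono_left nhdsWithin_le_nhds
    obtain ⟨t, ht, htpos⟩ := ((hcont.eventually (mem_interior_iff_mem_nhds.1 hx)).and
      self_mem_nhdsWithin).exists
    have h1 := ht r
    rw [Matrix.mulVec_sub, Matrix.mulVec_smul] at h1
    -- The value of row `r` drops by `t` times this squared length.
    have h2 : 0 < A.mulVec (A r) r := by
      have h3 : 0 ≤ A r ⬝ᵥ A r := Finset.sum_nonneg fun i _ => mul_self_nonneg _
      exact lt_of_le_of_ne h3 fun h => hr (dotProduct_self_eq_zero.1 h.symm)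
    have h3 := mul_pos (Set.mem_Ioi.1 htpos) h2
    simp only [Pi.sub_apply, Pi.smul_apply, smul_eq_mul] at h1
    linarith
  · rintro ⟨x, hx⟩
    have hopen : IsOpen (⋂ r, {p : ι → ℝ | A r ≠ 0 → 0 < A.mulVec p r}) := by
      refine isOpen_iInter_of_finite fun r => ?_
      by_cases hr : A r = 0
      · simp [hr]
      · simp only [ne_eq, hr, not_false_eq_true, forall_const]
        refine isOpen_lt continuous_const ?_
        unfold Matrix.mulVec dotProduct
        fun_prop
    refine ⟨x, interior_maximal ?_ hopen (Set.mem_iInter.2 hx)⟩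
    intro p hp r
    by_cases hr : A r = 0
    · exact (congrArg (· ⬝ᵥ p) hr).trans (zero_dotProduct p) |>.ge
    · exact (Set.mem_iInter.1 hp r hr).le

/-- A set in the hyperplane of coordinate sum `1` spans a linear space of one dimension more. -/
theorem finrank_span_eq_convexDim_add_one [Fintype ι] {s : Set (ι → ℝ)} (hne : s.Nonempty)
    (hs : ∀ p ∈ s, ∑ i, p i = 1) :
    Module.finrank ℝ (Submodule.span ℝ s) = convexDim s + 1 := by
  obtain ⟨q, hq⟩ := hne
  have hspan : Submodule.span ℝ s = vectorSpan ℝ s ⊔ Submodule.span ℝ {q} := by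
    apply le_antisymm
    · refine Submodule.span_le.2 fun p hp => ?_
      have h := Submodule.add_mem_sup (vsub_mem_vectorSpan ℝ hp hq)
        (Submodule.mem_span_singleton_self (R := ℝ) q)
      simpa using h
    · refine sup_le (Submodule.span_le.2 ?_)
        (Submodule.span_mono (Set.singleton_subset_iff.2 hq))
      rintro _ ⟨a, ha, b, hb, rfl⟩
      exact Submodule.sub_mem _ (Submodule.subset_span ha) (Submodule.subset_span hb)
  -- Directions have coordinate sum 0 while `q` has sum 1, so the sum in `hspan` is direct.
  have hsum : ∀ v ∈ vectorSpan ℝ s, ∑ i, v i = 0 := by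
    intro v hv
    refine Submodule.span_induction ?_ (by simp) ?_ ?_ hv
    · rintro _ ⟨a, ha, b, hb, rfl⟩
      simp [hs a ha, hs b hb]
    · intro x y _ _ hx hy
      simp [Finset.sum_add_distrib, hx, hy]
    · intro c x _ hx
      simp [← Finset.mul_sum, hx]
  have hinf : vectorSpan ℝ s ⊓ Submodule.span ℝ {q} = ⊥ := by
    rw [eq_bot_iff]
    rintro v ⟨hv, hv'⟩
    obtain ⟨c, rfl⟩ := Submodule.mem_span_singleton.1 hv'
    have h := hsum _ hv
    simp only [Pi.smul_apply, smul_eq_mul, ← Finset.mul_sum, hs q hq, mul_one] at h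
    simp [h]
  have hq0 : q ≠ 0 := by
    rintro rfl
    simpa using hs 0 hq
  have h := Submodule.finrank_sup_add_finrank_inf_eq (vectorSpan ℝ s) (Submodule.span ℝ {q})
  rw [hinf, finrank_bot, add_zero, finrank_span_singleton hq0, ← hspan] at h
  rw [h, convexDim, direction_affineSpan]

end Cones

/-! ### Payoff differences, the cone and the polytope of a game. -/

section Games

variable {n : ℕ} {d : Fin n → ℕ}

theorem extend_apply_self {i : Fin n} (k : Fin (d i)) (j : OthersStrategy d i) :
    extend k j i = k :=
  congrArg Prod.fst ((Equiv.piSplitAt i fun m => Fin (d m)).apply_symm_apply (k, j))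

theorem others_extend {i : Fin n} (k : Fin (d i)) (j : OthersStrategy d i) :
    others i (extend k j) = j :=
  congrArg Prod.snd ((Equiv.piSplitAt i fun m => Fin (d m)).apply_symm_apply (k, j))

theorem sum_eq_sum_extend (i : Fin n) (f : JointStrategy d → ℝ) :
    ∑ s, f s = ∑ k : Fin (d i), ∑ j : OthersStrategy d i, f (extend k j) := by
  rw [← Fintype.sum_prod_type']
  exact (Equiv.sum_comp (Equiv.piSplitAt i fun m => Fin (d m)).symm f).symm

theorem diff_self (Y : DiffVec d) (i : Fin n) (k : Fin (d i)) (j : OthersStrategy d i) :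
    diff Y i k k j = 0 := by
  simp [diff]

theorem diff_symm (Y : DiffVec d) (i : Fin n) (k l : Fin (d i)) (j : OthersStrategy d i) :
    diff Y i k l j = - diff Y i l k j := by
  unfold diff
  rcases lt_trichotomy k l with h | rfl | h
  · simp [h, h.not_gt]
  · simp
  · simp [h, h.not_gt]

theorem diff_payoffDiff (X : Payoffs d) (i : Fin n) (k l : Fin (d i)) (j : OthersStrategy d i) :
    diff (payoffDiff X) i k l j = X i (extend k j) - X i (extend l j) := by
  unfold diff payoffDiff
  rcases lt_trichotomy k l with h | rfl | h
  · simp [h]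
  · simp
  · simp [h, h.not_gt]

/-- With at most two strategies two of the three indices coincide, and antisymmetry suffices; this
is why 𝒮 imposes conditions only for `3 ≤ d i`. -/
theorem diff_add_diff {Y : DiffVec d} (hY : Y ∈ corrSpace d) (i : Fin n) (k l t : Fin (d i))
    (j : OthersStrategy d i) : diff Y i k l j + diff Y i l t j = diff Y i k t j := by
  by_cases hi : 3 ≤ d i
  · exact hY i hi k l t j
  · have h : k = l ∨ l = t ∨ k = t := by
      simp only [Fin.ext_iff]
      omega
    rcases h with rfl | rfl | rfl
    · rw [diff_self, zero_add]
    · rw [diff_self, add_zero]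
    · rw [diff_self, diff_symm Y i k l, neg_add_cancel]

theorem range_payoffDiff (hd : ∀ i, 1 ≤ d i) :
    Set.range (payoffDiff (d := d)) = (corrSpace d : Set (DiffVec d)) := by
  ext Y
  constructor
  · rintro ⟨X, rfl⟩ i _ k l t j
    simp only [diff_payoffDiff]
    ring
  · intro hY
    -- Take strategy 0 as reference: the payoff is the advantage of the strategy played over it.
    refine ⟨fun i s => diff Y i (s i) ⟨0, hd i⟩ (others i s), ?_⟩
    funext ⟨i, ⟨⟨k, l⟩, hkl⟩, j⟩
    have h := diff_add_diff hY i k l ⟨0, hd i⟩ j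
    have hY' : Y ⟨i, ⟨(k, l), hkl⟩, j⟩ = diff Y i k l j := by
      simp only [diff, dif_pos hkl]
    simp only [payoffDiff, extend_apply_self, others_extend, hY']
    linarith

theorem incentiveMatrix_mulVec (Y : DiffVec d) (p : JointStrategy d → ℝ) (r : IncentiveIndex d) :
    (incentiveMatrix Y).mulVec p r =
      ∑ j, diff Y r.1 r.2.1.1 r.2.1.2 j * p (extend r.2.1.1 j) := by
  unfold Matrix.mulVec dotProduct
  rw [sum_eq_sum_extend r.1, Finset.sum_eq_single r.2.1.1]
  · simp [incentiveMatrix, extend_apply_self, others_extend]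
  · intro k _ hk
    simp [incentiveMatrix, extend_apply_self, hk]
  · simp

theorem coneMatrix_mulVec_inl (Y : DiffVec d) (p : JointStrategy d → ℝ) (r : IncentiveIndex d) :
    (coneMatrix Y).mulVec p (Sum.inl r) = (incentiveMatrix Y).mulVec p r := by
  simp [coneMatrix, Matrix.fromRows_mulVec]

theorem coneMatrix_mulVec_inr (Y : DiffVec d) (p : JointStrategy d → ℝ) (s : JointStrategy d) :
    (coneMatrix Y).mulVec p (Sum.inr s) = p s := by
  simp [coneMatrix, Matrix.fromRows_mulVec]

theorem mem_corrCone_payoffDiff_iff (X : Payoffs d) (p : JointStrategy d → ℝ) :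
    p ∈ corrCone (payoffDiff X) ↔ (∀ s, 0 ≤ p s) ∧ ∀ (i : Fin n) (k l : Fin (d i)),
      0 ≤ ∑ j : OthersStrategy d i, (X i (extend k j) - X i (extend l j)) * p (extend k j) := by
  simp only [corrCone, Set.mem_ofPred_eq, Sum.forall, coneMatrix_mulVec_inl, coneMatrix_mulVec_inr,
    incentiveMatrix_mulVec, diff_payoffDiff]
  constructor
  · rintro ⟨h1, h2⟩
    refine ⟨h2, fun i k l => ?_⟩
    by_cases hkl : k = l
    · simp [hkl]
    · exact h1 ⟨i, ⟨(k, l), hkl⟩⟩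
  · rintro ⟨h1, h2⟩
    exact ⟨fun r => h2 r.1 r.2.1.1 r.2.1.2, h1⟩

theorem zero_mem_corrCone (Y : DiffVec d) : (0 : JointStrategy d → ℝ) ∈ corrCone Y := by
  intro r
  simp

theorem card_jointStrategy : Fintype.card (JointStrategy d) = ∏ i, d i := by
  simp

theorem corrPolytope_subset_corrCone (X : Payoffs d) :
    corrPolytope X ⊆ corrCone (payoffDiff X) := fun p hp =>
  (mem_corrCone_payoffDiff_iff X p).2 ⟨hp.1.1, hp.2⟩

theorem inv_sum_smul_mem_corrPolytope {X : Payoffs d} {p : JointStrategy d → ℝ}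
    (hp : p ∈ corrCone (payoffDiff X)) (h0 : p ≠ 0) :
    0 < ∑ s, p s ∧ (∑ s, p s)⁻¹ • p ∈ corrPolytope X := by
  obtain ⟨hp1, hp2⟩ := (mem_corrCone_payoffDiff_iff X p).1 hp
  have hpos : 0 < ∑ s, p s := by
    refine lt_of_le_of_ne (Finset.sum_nonneg fun s _ => hp1 s) fun h => h0 ?_
    funext s
    exact (Finset.sum_eq_zero_iff_of_nonneg fun s _ => hp1 s).1 h.symm s (Finset.mem_univ s)
  refine ⟨hpos, ⟨fun s => mul_nonneg (inv_nonneg.2 hpos.le) (hp1 s), ?_⟩, fun i k l => ?_⟩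
  · simp only [Pi.smul_apply, smul_eq_mul, ← Finset.mul_sum]
    exact inv_mul_cancel₀ hpos.ne'
  · simp only [Pi.smul_apply, smul_eq_mul, mul_left_comm _ (∑ s, p s)⁻¹, ← Finset.mul_sum]
    exact mul_nonneg (inv_nonneg.2 hpos.le) (hp2 i k l)

/-- Every nonzero vector of the cone is a positive multiple of a point of the polytope. -/
theorem span_corrCone_payoffDiff (X : Payoffs d) :
    Submodule.span ℝ (corrCone (payoffDiff X)) = Submodule.span ℝ (corrPolytope X) := by
  refine le_antisymm (Submodule.span_le.2 fun p hp => ?_)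
    (Submodule.span_mono (corrPolytope_subset_corrCone X))
  by_cases h0 : p = 0
  · rw [h0]
    exact Submodule.zero_mem _
  · obtain ⟨hpos, hmem⟩ := inv_sum_smul_mem_corrPolytope hp h0
    have h := Submodule.smul_mem _ (∑ s, p s) (Submodule.subset_span (R := ℝ) hmem)
    rwa [smul_inv_smul₀ hpos.ne'] at h

/-- Guards against the default `convexDim ∅ = 0`, by which an empty polytope would seem to have
dimension D - 1 when D = 1. -/
theorem corrPolytope_nonempty_of_prod_eq_one (X : Payoffs d) (h : ∏ i, d i = 1) :
    (corrPolytope X).Nonempty := by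
  have hcard : Fintype.card (JointStrategy d) = 1 := card_jointStrategy.trans h
  have hsub : Subsingleton (JointStrategy d) :=
    Fintype.card_le_one_iff_subsingleton.1 hcard.le
  refine ⟨fun _ => 1, ⟨fun _ => zero_le_one, ?_⟩, fun i k l => ?_⟩
  · rw [Finset.sum_const, Finset.card_univ, hcard, one_smul]
  · refine Finset.sum_nonneg fun j _ => ?_
    rw [Subsingleton.elim (extend k j) (extend l j)]
    simp

theorem payoffDiff_mem_fullDimRegion_iff (hd : ∀ i, 1 ≤ d i) (X : Payoffs d) :
    payoffDiff X ∈ fullDimRegion d ↔ convexDim (corrPolytope X) + 1 = ∏ i, d i := by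
  have hS : payoffDiff X ∈ corrSpace d := by
    rw [← SetLike.mem_coe, ← range_payoffDiff hd]
    exact Set.mem_range_self X
  have hD : 0 < ∏ i, d i := Finset.prod_pos fun i _ => hd i
  change (payoffDiff X ∈ corrSpace d ∧ convexDim (corrCone (payoffDiff X)) = ∏ i, d i) ↔ _
  rw [and_iff_right hS, convexDim_eq_finrank_span (zero_mem_corrCone _),
    span_corrCone_payoffDiff]
  rcases Set.eq_empty_or_nonempty (corrPolytope X) with he | hne
  · refine iff_of_false ?_ fun h => ?_
    · rw [he, Submodule.span_empty, finrank_bot]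
      exact hD.ne
    · refine (corrPolytope_nonempty_of_prod_eq_one X ?_).ne_empty he
      rw [← h, he, convexDim, direction_affineSpan, vectorSpan_empty, finrank_bot]
  · rw [finrank_span_eq_convexDim_add_one hne fun p hp => hp.1.2]

/-! ### Polynomial dependence on Y and descriptions of the region. -/

/-- The polynomial in the variables `Y` whose value is `diff Y i k l j`. -/
noncomputable def diffPoly (i : Fin n) (k l : Fin (d i)) (j : OthersStrategy d i) :
    MvPolynomial (DiffIndex d) ℝ :=
  if h : k < l then MvPolynomial.X ⟨i, ⟨(k, l), h⟩, j⟩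
  else if h : l < k then - MvPolynomial.X ⟨i, ⟨(l, k), h⟩, j⟩
  else 0

theorem eval_diffPoly (Y : DiffVec d) (i : Fin n) (k l : Fin (d i)) (j : OthersStrategy d i) :
    MvPolynomial.eval Y (diffPoly i k l j) = diff Y i k l j := by
  unfold diffPoly diff
  split_ifs <;> simp

/-- The matrix `A(Y)` with polynomial entries in the variables `Y`. -/
noncomputable def conePolyMatrix (d : Fin n → ℕ) :
    Matrix (IncentiveIndex d ⊕ JointStrategy d) (JointStrategy d)
      (MvPolynomial (DiffIndex d) ℝ) :=
  Matrix.fromRows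
    (Matrix.of fun r s =>
      if s r.1 = r.2.1.1 then diffPoly r.1 r.2.1.1 r.2.1.2 (others r.1 s) else 0) 1

theorem conePolyMatrix_map_eval (Y : DiffVec d) :
    (conePolyMatrix d).map (MvPolynomial.eval Y) = coneMatrix Y := by
  ext r s
  rcases r with r | r
  · simp [conePolyMatrix, coneMatrix, incentiveMatrix, apply_ite (MvPolynomial.eval Y),
      eval_diffPoly]
  · simp [conePolyMatrix, coneMatrix, Matrix.one_apply, apply_ite (MvPolynomial.eval Y)]

theorem isSemialgebraic_corrSpace (d : Fin n → ℕ) :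
    IsSemialgebraic (corrSpace d : Set (DiffVec d)) := by
  have h : IsSemialgebraic (⋂ i : {i : Fin n // 3 ≤ d i}, ⋂ k : Fin (d i), ⋂ l : Fin (d i),
      ⋂ t : Fin (d i), ⋂ j : OthersStrategy d i,
      {Y | MvPolynomial.eval Y (diffPoly i.1 k l j + diffPoly i.1 l t j - diffPoly i.1 k t j) = 0}) :=
    isSemialgebraic_iInter fun i => isSemialgebraic_iInter fun k => isSemialgebraic_iInter fun l =>
      isSemialgebraic_iInter fun t => isSemialgebraic_iInter fun j => isSemialgebraic_eval_eq_zero _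
  convert h using 1
  ext Y
  simp only [Set.mem_iInter, Set.mem_ofPred_eq, map_sub, map_add, eval_diffPoly, sub_eq_zero]
  exact ⟨fun hY i => hY i.1 i.2, fun hY i hi => hY ⟨i, hi⟩⟩

theorem mem_strictProjection_iff (Y : DiffVec d) :
    Y ∈ strictProjection d ↔ ∃ x, ∀ r, 0 < (coneMatrix Y).mulVec x r := by
  simp [strictProjection]

theorem mem_reducedStrictProjection_iff (Y : DiffVec d) :
    Y ∈ reducedStrictProjection d ↔
      ∃ x, ∀ r, coneMatrix Y r ≠ 0 → 0 < (coneMatrix Y).mulVec x r := by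
  simp only [reducedStrictProjection, Set.mem_image, Set.mem_ofPred_eq, Prod.exists,
    exists_eq_right]

theorem isSemialgebraic_strictProjection (d : Fin n → ℕ) :
    IsSemialgebraic (strictProjection d) := by
  convert isSemialgebraic_exists_mulVec_pos (conePolyMatrix d) using 1
  ext Y
  rw [mem_strictProjection_iff, Set.mem_ofPred_eq, conePolyMatrix_map_eval]

theorem isSemialgebraic_reducedStrictProjection (d : Fin n → ℕ) :
    IsSemialgebraic (reducedStrictProjection d) := by
  convert isSemialgebraic_exists_mulVec_pos_of_ne_zero (conePolyMatrix d) using 1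
  ext Y
  rw [mem_reducedStrictProjection_iff, Set.mem_ofPred_eq, conePolyMatrix_map_eval]

theorem fullDimRegion_eq (d : Fin n → ℕ) :
    fullDimRegion d = reducedStrictProjection d ∩ (corrSpace d : Set (DiffVec d)) := by
  ext Y
  have hconv : Convex ℝ (corrCone Y) := convex_setOf_mulVec_nonneg (coneMatrix Y)
  change (Y ∈ corrSpace d ∧ convexDim (corrCone Y) = ∏ i, d i) ↔
    Y ∈ reducedStrictProjection d ∧ Y ∈ corrSpace d
  rw [and_comm, ← card_jointStrategy, convexDim_eq_card_iff hconv ⟨0, zero_mem_corrCone Y⟩,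
    mem_reducedStrictProjection_iff, corrCone, interior_setOf_mulVec_nonneg_nonempty_iff]

theorem coneMatrix_row_ne_zero_of_mulVec_pos {Y : DiffVec d} {x : JointStrategy d → ℝ}
    {r : IncentiveIndex d ⊕ JointStrategy d} (h : 0 < (coneMatrix Y).mulVec x r) :
    coneMatrix Y r ≠ 0 := fun h0 =>
  h.ne' ((congrArg (· ⬝ᵥ x) h0).trans (zero_dotProduct x))

theorem coneMatrix_row_inr_ne_zero (Y : DiffVec d) (s : JointStrategy d) :
    coneMatrix Y (Sum.inr s) ≠ 0 := by
  apply coneMatrix_row_ne_zero_of_mulVec_pos (x := fun _ => 1)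
  rw [coneMatrix_mulVec_inr]
  exact one_pos

theorem strictProjection_eq (d : Fin n → ℕ) :
    strictProjection d = reducedStrictProjection d ∩ {Y | ∀ r, incentiveMatrix Y r ≠ 0} := by
  ext Y
  rw [Set.mem_inter_iff, mem_strictProjection_iff, mem_reducedStrictProjection_iff]
  constructor
  · rintro ⟨x, hx⟩
    exact ⟨⟨x, fun r _ => hx r⟩,
      fun r => coneMatrix_row_ne_zero_of_mulVec_pos (hx (Sum.inl r))⟩
  · rintro ⟨⟨x, hx⟩, hrow⟩
    refine ⟨x, fun r => hx r ?_⟩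
    rcases r with r | s
    · exact hrow r
    · exact coneMatrix_row_inr_ne_zero Y s

end Games

end CorrelatedEq

theorem mainTheorem1 {n : ℕ} (d : Fin n → ℕ) (hd : ∀ i, 1 ≤ d i) :
    -- the region is semialgebraic, and so is its explicit description
    CorrelatedEq.IsSemialgebraic (CorrelatedEq.fullDimRegion d) ∧
    CorrelatedEq.IsSemialgebraic
      (CorrelatedEq.strictProjection d ∩ (CorrelatedEq.corrSpace d : Set _)) ∧
    -- the explicit description, where no incentive constraint is trivial
    CorrelatedEq.fullDimRegion d ∩ {Y | ∀ r, CorrelatedEq.incentiveMatrix Y r ≠ 0} =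
      CorrelatedEq.strictProjection d ∩ (CorrelatedEq.corrSpace d : Set _) ∧
    -- the explicit description of the whole region
    CorrelatedEq.fullDimRegion d =
      CorrelatedEq.reducedStrictProjection d ∩ (CorrelatedEq.corrSpace d : Set _) ∧
    -- the space consists of the payoff-difference vectors of games, and the region consists of
    -- those of the games whose correlated equilibrium polytope has the maximal dimension
    Set.range (CorrelatedEq.payoffDiff (d := d)) = (CorrelatedEq.corrSpace d : Set _) ∧
    (∀ X : CorrelatedEq.Payoffs d,
      CorrelatedEq.payoffDiff X ∈ CorrelatedEq.fullDimRegion d ↔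
        CorrelatedEq.convexDim (CorrelatedEq.corrPolytope X) + 1 = ∏ i, d i) := by
  refine ⟨?_, (CorrelatedEq.isSemialgebraic_strictProjection d).inter
    (CorrelatedEq.isSemialgebraic_corrSpace d), ?_, CorrelatedEq.fullDimRegion_eq d,
    CorrelatedEq.range_payoffDiff hd, CorrelatedEq.payoffDiff_mem_fullDimRegion_iff hd⟩
  · rw [CorrelatedEq.fullDimRegion_eq]
    exact (CorrelatedEq.isSemialgebraic_reducedStrictProjection d).inter
      (CorrelatedEq.isSemialgebraic_corrSpace d)
  · rw [CorrelatedEq.fullDimRegion_eq, CorrelatedEq.strictProjection_eq, Set.inter_right_comm]
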